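/- There exists a universal constant $K<\infty$ such that the following holds. Let $n$ be a positive integer, let $Z_1,\dots,Z_n$ be independent random variables, each uniformly distributed over $\{1,i,-1,-i\}$, and let $\varepsilon\ge 0$. Then, for any vector $a\in\mathbb{C}^n$ such that $\|a\|_{\ell_\infty}\le\varepsilon\|a\|_{\ell_2}$, where $\|a\|_{\ell_\infty}=\max_j|a_j|$ and $\|a\|_{\ell_2}=\big(\sum_j|a_j|^2\big)^{1/2}$, we have \[ \mathbf{E}\Big[\Big|\sum_{j=1}^n Z_ja_j\Big|\Big]\le\Big(\sqrt{\tfrac{\pi}{4}}+K\sqrt{\varepsilon}\Big)\|a\|_{\ell_2}. \] -/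

import Mathlib

open MeasureTheory ProbabilityTheory

/-! The modulus is a superposition of Gaussians: `√(π/4) |z| = ∫₀^∞ (1 - exp(-|z|²t²/4)) / t² dt`.
So an upper bound for `E|S|`, `S = ∑ Z_j b_j`, follows from a lower bound for `E exp(-|S|²t²/4)`.
The Gaussian is in turn a Fourier integral over `v ∈ ℂ`, which brings in `E cos⟨tS, v⟩`, a product
of averages of two cosines by independence and symmetry.

For `∑ |b_j|² = 1` and `|b_j| ≤ δ`, that product is at least `exp(-u²/4)`, `u = t|v|`, up to an
error of order `(δu)²/(1 + (δu)²)` (`gaussian_sub_le_prod_half_cos_add_cos`). Integrating in `v`,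
then in `t`, the main term gives the mean modulus `√(π/4)` of a standard complex Gaussian. The error
is quadratic near `0` and bounded at infinity, so against `dt/t²` it costs only `O(δ)`. Thus the
bound is linear in `δ`; `√ε` is weaker. -/

/-! ### The modulus as an integral of Gaussians -/

theorem one_sub_exp_div_sq_nonneg {b : ℝ} (hb : 0 ≤ b) (t : ℝ) :
    0 ≤ (1 - Real.exp (-(b * t ^ 2))) / t ^ 2 := by
  have : Real.exp (-(b * t ^ 2)) ≤ 1 := Real.exp_le_one_iff.2 (by nlinarith [sq_nonneg t])
  exact div_nonneg (by linarith) (sq_nonneg t)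

theorem one_sub_exp_div_sq_le {b t : ℝ} (ht : t ≠ 0) :
    (1 - Real.exp (-(b * t ^ 2))) / t ^ 2 ≤ (1 + b) * (1 + t ^ 2)⁻¹ := by
  have ht2 : 0 < t ^ 2 := by positivity
  have h1 := Real.add_one_le_exp (-(b * t ^ 2))
  have h2 := Real.exp_pos (-(b * t ^ 2))
  rw [← div_eq_mul_inv, div_le_div_iff₀ ht2 (by positivity)]
  nlinarith

theorem integrableOn_one_sub_exp_div_sq {b : ℝ} (hb : 0 ≤ b) :
    IntegrableOn (fun t : ℝ => (1 - Real.exp (-(b * t ^ 2))) / t ^ 2) (Set.Ioi 0) := by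
  refine Integrable.mono' ((integrable_inv_one_add_sq.const_mul (1 + b)).integrableOn)
    (by fun_prop : Measurable _).aestronglyMeasurable ?_
  filter_upwards [ae_restrict_mem measurableSet_Ioi] with t ht
  rw [Real.norm_of_nonneg (one_sub_exp_div_sq_nonneg hb t)]
  exact one_sub_exp_div_sq_le (ne_of_gt ht)

/-- Integration by parts reduces this to the half-line Gaussian integral; both boundary terms
vanish. -/
theorem integral_one_sub_exp_div_sq {b : ℝ} (hb : 0 < b) :
    ∫ t in Set.Ioi (0 : ℝ), (1 - Real.exp (-(b * t ^ 2))) / t ^ 2 = √(Real.pi * b) := by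
  have hg : Integrable (fun t : ℝ => 2 * b * Real.exp (-b * t ^ 2)) :=
    (integrable_exp_neg_mul_sq hb).const_mul _
  have hbd : ∀ t : ℝ, 0 ≤ 1 - Real.exp (-(b * t ^ 2)) ∧ 1 - Real.exp (-(b * t ^ 2)) ≤ 1 ∧
      1 - Real.exp (-(b * t ^ 2)) ≤ b * t ^ 2 := fun t => by
    refine ⟨?_, ?_, ?_⟩
    · have : Real.exp (-(b * t ^ 2)) ≤ 1 := Real.exp_le_one_iff.2 (by nlinarith [sq_nonneg t])
      linarith
    · linarith [Real.exp_pos (-(b * t ^ 2))]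
    · linarith [Real.add_one_le_exp (-(b * t ^ 2))]
  have key := integral_Ioi_of_hasDerivAt_of_tendsto (a := (0 : ℝ)) (m := (0 : ℝ))
    (f := fun t : ℝ => -((1 - Real.exp (-(b * t ^ 2))) / t))
    (f' := fun t => (1 - Real.exp (-(b * t ^ 2))) / t ^ 2 - 2 * b * Real.exp (-b * t ^ 2))
    ?_ ?_ ((integrableOn_one_sub_exp_div_sq hb.le).sub hg.integrableOn) ?_
  · rw [integral_sub (integrableOn_one_sub_exp_div_sq hb.le) hg.integrableOn,
      integral_const_mul, integral_gaussian_Ioi] at key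
    simp only [div_zero, neg_zero, sub_zero] at key
    rw [sub_eq_zero.1 key, show Real.pi * b = Real.pi / b * b ^ 2 by field_simp,
      Real.sqrt_mul (by positivity), Real.sqrt_sq hb.le]
    ring
  -- The default value of the quotient at `t = 0` is `0`, which is also its limit.
  · have h : Filter.Tendsto (fun t : ℝ => -((1 - Real.exp (-(b * t ^ 2))) / t))
        (nhdsWithin 0 (Set.Ici 0)) (nhds 0) := by
      refine squeeze_zero_norm (a := fun t => b * |t|) (fun t => ?_) ?_
      · rw [norm_neg, norm_div, Real.norm_of_nonneg (hbd t).1, Real.norm_eq_abs]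
        rcases eq_or_ne t 0 with rfl | ht
        · simp
        · rw [div_le_iff₀ (abs_pos.2 ht)]
          nlinarith [(hbd t).2.2, sq_abs t]
      · have : Continuous fun t : ℝ => b * |t| := by fun_prop
        simpa using (this.tendsto 0).mono_left nhdsWithin_le_nhds
    simpa [ContinuousWithinAt] using h
  · intro t ht
    have ht' : t ≠ 0 := ne_of_gt ht
    have h1 : HasDerivAt (fun t : ℝ => -(b * t ^ 2)) (-(b * (2 * t))) t := by
      simpa using ((hasDerivAt_pow 2 t).const_mul b).fun_neg
    have h2 := (((h1.exp).const_sub 1).fun_div (hasDerivAt_id' t) ht').fun_neg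
    convert h2 using 1
    simp only [neg_mul]
    field_simp
    ring
  · refine squeeze_zero_norm' (a := fun t : ℝ => t⁻¹) ?_ tendsto_inv_atTop_zero
    filter_upwards [Filter.eventually_gt_atTop 0] with t ht
    rw [norm_neg, norm_div, Real.norm_of_nonneg (hbd t).1, Real.norm_of_nonneg ht.le,
      ← one_div]
    gcongr
    exact (hbd t).2.1

theorem integral_one_sub_exp_norm_sq_div_sq (z : ℂ) :
    ∫ t in Set.Ioi (0 : ℝ), (1 - Real.exp (-(‖z‖ ^ 2 / 4 * t ^ 2))) / t ^ 2
      = √(Real.pi / 4) * ‖z‖ := by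
  rcases eq_or_ne z 0 with rfl | hz
  · simp
  · rw [integral_one_sub_exp_div_sq (by positivity),
      show Real.pi * (‖z‖ ^ 2 / 4) = Real.pi / 4 * ‖z‖ ^ 2 by ring,
      Real.sqrt_mul (by positivity), Real.sqrt_sq (norm_nonneg z)]

theorem integral_Ioi_inv_one_add_mul_sq {c : ℝ} (hc : 0 < c) :
    ∫ t in Set.Ioi (0 : ℝ), (1 + (c * t) ^ 2)⁻¹ = Real.pi / 2 / c := by
  have := integral_comp_mul_left_Ioi (fun t : ℝ => (1 + t ^ 2)⁻¹) 0 hc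
  rw [this]
  simp only [mul_zero, integral_Ioi_inv_one_add_sq, Real.arctan_zero, sub_zero, smul_eq_mul]
  field_simp

theorem integrable_inv_one_add_mul_sq {c : ℝ} (hc : c ≠ 0) :
    Integrable fun t : ℝ => (1 + (c * t) ^ 2)⁻¹ :=
  integrable_inv_one_add_sq.comp_mul_left' hc

/-! ### Gaussian integrals over the plane -/

theorem integrable_exp_neg_mul_norm_sq {b : ℝ} (hb : 0 < b) :
    Integrable fun v : ℂ => Real.exp (-b * ‖v‖ ^ 2) := by
  have h := (GaussianFourier.integrable_cexp_neg_mul_sq_norm_add (V := ℂ) (b := b)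
    (by simpa using hb) 0 0).re
  refine h.congr (Filter.Eventually.of_forall fun v => ?_)
  simp only [zero_mul, add_zero]
  rw [← Complex.ofReal_pow, ← Complex.ofReal_neg, ← Complex.ofReal_mul]
  exact Complex.exp_ofReal_re _

theorem integral_exp_neg_mul_norm_sq {b : ℝ} (hb : 0 < b) :
    ∫ v : ℂ, Real.exp (-b * ‖v‖ ^ 2) = Real.pi / b := by
  rw [GaussianFourier.integral_rexp_neg_mul_sq_norm hb]
  simp [Complex.finrank_real_complex]

theorem integrable_exp_neg_norm_sq : Integrable fun v : ℂ => Real.exp (-‖v‖ ^ 2) := by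
  simpa using integrable_exp_neg_mul_norm_sq one_pos

theorem integral_exp_neg_norm_sq_mul_cos (w : ℂ) :
    ∫ v : ℂ, Real.exp (-‖v‖ ^ 2) * Real.cos (inner ℝ w v)
      = Real.pi * Real.exp (-(‖w‖ ^ 2 / 4)) := by
  have hint := GaussianFourier.integrable_cexp_neg_mul_sq_norm_add (V := ℂ) (b := 1)
    (by simp) Complex.I w
  have h := GaussianFourier.integral_cexp_neg_mul_sq_norm_add (V := ℂ) (b := 1)
    (by simp) Complex.I w
  have h' := congrArg Complex.re h
  rw [← RCLike.re_eq_complex_re, ← integral_re hint] at h'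
  have e : ∀ v : ℂ, RCLike.re (Complex.exp (-1 * (‖v‖ : ℂ) ^ 2 + Complex.I * (inner ℝ w v : ℝ)))
      = Real.exp (-‖v‖ ^ 2) * Real.cos (inner ℝ w v) := fun v => by
    rw [RCLike.re_eq_complex_re, Complex.exp_re]
    congr 1
    · congr 1
      simp [← Complex.ofReal_pow]
    · congr 1
      simp [← Complex.ofReal_pow]
  simp only [e] at h'
  rw [h']
  have : ((Real.pi : ℂ) / 1) ^ ((Module.finrank ℝ ℂ : ℂ) / 2)
      * Complex.exp (Complex.I ^ 2 * (‖w‖ : ℂ) ^ 2 / (4 * 1))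
      = ((Real.pi * Real.exp (-(‖w‖ ^ 2 / 4)) : ℝ) : ℂ) := by
    rw [Complex.finrank_real_complex]
    push_cast
    simp [neg_div]
  rw [this, RCLike.re_eq_complex_re, Complex.ofReal_re]

/-! ### Products of cosines against a Gaussian -/

/-- From `cos x ≥ 1 - x²/2` the average is at least `1 - x` with `x = r²/4`, and `(1 - x)(1 + x +
2x²) ≥ 1` for `0 ≤ x ≤ 1/2`. -/
theorem exp_neg_le_half_cos_add_cos {p q r : ℝ} (h : p ^ 2 + q ^ 2 = r ^ 2)
    (hr : r ^ 2 ≤ 1) :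
    Real.exp (-(r ^ 2 / 4 + r ^ 4 / 8)) ≤ (Real.cos p + Real.cos q) / 2 := by
  have hp := Real.one_sub_sq_div_two_le_cos (x := p)
  have hq := Real.one_sub_sq_div_two_le_cos (x := q)
  have h1 : 1 - r ^ 2 / 4 ≤ (Real.cos p + Real.cos q) / 2 := by linarith
  refine le_trans ?_ h1
  have h2 := Real.add_one_le_exp (r ^ 2 / 4 + r ^ 4 / 8)
  have h3 := sq_nonneg r
  rw [Real.exp_neg, inv_le_comm₀ (Real.exp_pos _) (by linarith)]
  refine le_trans ?_ h2
  rw [inv_le_iff_one_le_mul₀ (by linarith)]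
  have : r ^ 4 = r ^ 2 * r ^ 2 := by ring
  rw [this]
  nlinarith [mul_nonneg h3 h3, mul_nonneg (mul_nonneg h3 h3) (sub_nonneg.2 hr)]

theorem gaussian_sub_le_prod_half_cos_add_cos {ι : Type*} [Fintype ι] {p q r : ι → ℝ} {δ u : ℝ}
    (hpq : ∀ j, p j ^ 2 + q j ^ 2 = (u * r j) ^ 2) (hr : ∀ j, |r j| ≤ δ)
    (hsum : ∑ j, r j ^ 2 = 1) :
    Real.exp (-(u ^ 2 / 4)) - 4 * ((δ * u) ^ 2 / (1 + (δ * u) ^ 2))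
      ≤ ∏ j, (Real.cos (p j) + Real.cos (q j)) / 2 := by
  have hr2 : ∀ j, r j ^ 2 ≤ δ ^ 2 := fun j => by
    rw [← sq_abs]; exact pow_le_pow_left₀ (abs_nonneg _) (hr j) 2
  rcases le_total ((δ * u) ^ 2) 1 with hsmall | hlarge
  · have h1 : Real.exp (-(u ^ 2 / 4 + δ ^ 2 * u ^ 4 / 8))
        ≤ ∏ j, (Real.cos (p j) + Real.cos (q j)) / 2 := by
      calc Real.exp (-(u ^ 2 / 4 + δ ^ 2 * u ^ 4 / 8))
          ≤ Real.exp (∑ j, -((u * r j) ^ 2 / 4 + (u * r j) ^ 4 / 8)) := by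
            rw [Real.exp_le_exp, Finset.sum_neg_distrib, Finset.sum_add_distrib]
            have e1 : ∑ j, (u * r j) ^ 2 / 4 = u ^ 2 / 4 := by
              simp only [mul_pow]
              rw [← Finset.sum_div, ← Finset.mul_sum, hsum, mul_one]
            have e2 : ∑ j, (u * r j) ^ 4 / 8 ≤ δ ^ 2 * u ^ 4 / 8 := by
              calc ∑ j, (u * r j) ^ 4 / 8 ≤ ∑ j, δ ^ 2 * u ^ 4 / 8 * r j ^ 2 := by
                    refine Finset.sum_le_sum fun j _ => ?_
                    have := mul_le_mul_of_nonneg_left (hr2 j)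
                      (by positivity : 0 ≤ u ^ 4 * r j ^ 2 / 8)
                    nlinarith
                _ = δ ^ 2 * u ^ 4 / 8 := by rw [← Finset.mul_sum, hsum, mul_one]
            linarith
        _ = ∏ j, Real.exp (-((u * r j) ^ 2 / 4 + (u * r j) ^ 4 / 8)) := Real.exp_sum _ _
        _ ≤ _ := by
            refine Finset.prod_le_prod (fun j _ => (Real.exp_pos _).le) fun j _ => ?_
            refine exp_neg_le_half_cos_add_cos (hpq j) (le_trans ?_ hsmall)
            rw [mul_pow, mul_pow, mul_comm]
            exact mul_le_mul_of_nonneg_right (hr2 j) (sq_nonneg u)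
    refine le_trans ?_ h1
    rw [neg_add, Real.exp_add]
    have h2 := Real.add_one_le_exp (-(δ ^ 2 * u ^ 4 / 8))
    have h3 := Real.exp_pos (-(u ^ 2 / 4))
    -- The loss `exp(-u²/4) δ²u⁴/8` factors as `exp(-u²/4)(u²/4)` times `(δu)²/2`.
    have h4 : Real.exp (-(u ^ 2 / 4)) * (u ^ 2 / 4) ≤ 1 := by
      have h5 := Real.add_one_le_exp (u ^ 2 / 4)
      rw [Real.exp_neg, inv_mul_le_iff₀ (Real.exp_pos _)]
      linarith
    have h6 : (δ * u) ^ 2 / 2 ≤ (δ * u) ^ 2 / (1 + (δ * u) ^ 2) := by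
      gcongr; linarith
    have h7 := mul_le_mul_of_nonneg_left h2 h3.le
    have h8 := mul_le_mul_of_nonneg_right h4 (by positivity : 0 ≤ (δ * u) ^ 2 / 2)
    nlinarith [sq_nonneg (δ * u)]
  -- Here the constant `4` makes the left side at most `1 - 2 = -1`, a trivial lower bound for the
  -- product.
  · have h1 : (1 : ℝ) / 2 ≤ (δ * u) ^ 2 / (1 + (δ * u) ^ 2) := by
      rw [div_le_div_iff₀ (by norm_num) (by positivity)]; linarith
    have h2 : Real.exp (-(u ^ 2 / 4)) ≤ 1 := Real.exp_le_one_iff.2 (by nlinarith [sq_nonneg u])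
    have h3 : |∏ j, (Real.cos (p j) + Real.cos (q j)) / 2| ≤ 1 := by
      rw [Finset.abs_prod]
      refine Finset.prod_le_one (fun _ _ => abs_nonneg _) fun j _ => abs_le.2 ⟨?_, ?_⟩
      · linarith [Real.neg_one_le_cos (p j), Real.neg_one_le_cos (q j)]
      · linarith [Real.cos_le_one (p j), Real.cos_le_one (q j)]
    linarith [(abs_le.1 h3).1]

/-- Used with `y = |v|²`, `s = (δt)²` to separate the two variables before integrating in `v`. -/
theorem mul_div_one_add_mul_le {y s : ℝ} (hy : 0 ≤ y) (hs : 0 ≤ s) :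
    y * s / (1 + y * s) ≤ (1 + y) * (s / (1 + s)) := by
  have hys := mul_nonneg hy hs
  rw [← mul_div_assoc, div_le_div_iff₀ (by positivity) (by positivity)]
  nlinarith [mul_nonneg hys hys, mul_nonneg hys hy, mul_nonneg hys hs]

/-! ### Fourth roots of unity and their characteristic function -/

theorem integral_uniformOn_fourthRoots {E : Type*} [NormedAddCommGroup E] [NormedSpace ℝ E]
    [CompleteSpace E] (f : ℂ → E) :
    ∫ z, f z ∂(uniformOn ({1, Complex.I, -1, -Complex.I} : Set ℂ))
      = (4 : ℝ)⁻¹ • (f 1 + f Complex.I + f (-1) + f (-Complex.I)) := by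
  have hs : ({1, Complex.I, -1, -Complex.I} : Set ℂ)
      = (({1, Complex.I, -1, -Complex.I} : Finset ℂ) : Set ℂ) := by simp
  have h1 : (1 : ℂ) ∉ ({Complex.I, -1, -Complex.I} : Finset ℂ) := by
    simp [Complex.ext_iff]; norm_num
  have h2 : Complex.I ∉ ({-1, -Complex.I} : Finset ℂ) := by
    simp [Complex.ext_iff]; norm_num
  have h3 : (-1 : ℂ) ∉ ({-Complex.I} : Finset ℂ) := by
    simp [Complex.ext_iff]
  have hint : IntegrableOn f (({1, Complex.I, -1, -Complex.I} : Finset ℂ) : Set ℂ)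
      Measure.count := by
    rw [← (({1, Complex.I, -1, -Complex.I} : Finset ℂ) : Set ℂ).biUnion_of_singleton]
    exact integrableOn_finset_iUnion.2 fun x _ => integrableOn_singleton (by simp) (by simp)
  rw [hs, uniformOn, ProbabilityTheory.cond, integral_smul_measure, Measure.count_apply_finset,
    setIntegral_finset _ hint]
  rw [Finset.sum_insert h1, Finset.sum_insert h2, Finset.sum_insert h3, Finset.sum_singleton,
    Finset.card_insert_of_notMem h1, Finset.card_insert_of_notMem h2,
    Finset.card_insert_of_notMem h3, Finset.card_singleton]
  simp [add_assoc]

theorem ae_norm_eq_one_of_hasLaw_fourthRoots {Ω : Type*} [MeasurableSpace Ω] {P : Measure Ω}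
    {Z : Ω → ℂ} (h : HasLaw Z (uniformOn ({1, Complex.I, -1, -Complex.I} : Set ℂ)) P) :
    ∀ᵐ ω ∂P, ‖Z ω‖ = 1 := by
  have hs : MeasurableSet ({1, Complex.I, -1, -Complex.I} : Set ℂ) :=
    (Set.toFinite _).measurableSet
  have : ∀ᵐ z ∂(uniformOn ({1, Complex.I, -1, -Complex.I} : Set ℂ)), ‖z‖ = 1 := by
    unfold uniformOn
    filter_upwards [ae_cond_mem hs] with z hz
    rcases hz with rfl | rfl | rfl | rfl <;> simp
  rw [← h.map_eq] at this
  exact ae_of_ae_map h.aemeasurable this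

theorem integral_exp_inner_of_hasLaw_fourthRoots {Ω : Type*} [MeasurableSpace Ω] {P : Measure Ω}
    {Z : Ω → ℂ} (h : HasLaw Z (uniformOn ({1, Complex.I, -1, -Complex.I} : Set ℂ)) P) (b v : ℂ) :
    ∫ ω, Complex.exp (Complex.I * (inner ℝ (Z ω * b) v : ℝ)) ∂P
      = (((Real.cos (inner ℝ b v) + Real.cos (inner ℝ (Complex.I * b) v)) / 2 : ℝ) : ℂ) := by
  have hm : Measurable fun z : ℂ => Complex.exp (Complex.I * (inner ℝ (z * b) v : ℝ)) := by
    have : Continuous fun z : ℂ => Complex.exp (Complex.I * (inner ℝ (z * b) v : ℝ)) := by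
      fun_prop
    exact this.measurable
  have := h.integral_comp (f := fun z : ℂ => Complex.exp (Complex.I * (inner ℝ (z * b) v : ℝ)))
    hm.aestronglyMeasurable
  simp only [Function.comp_def] at this
  rw [this, integral_uniformOn_fourthRoots]
  simp only [one_mul, neg_mul, inner_neg_left, Complex.ofReal_neg, Complex.real_smul]
  push_cast
  rw [Complex.cos, Complex.cos]
  simp only [mul_comm _ Complex.I, mul_neg]
  ring

/-- Pythagoras: `b` and `ib` are orthogonal and of equal length. -/
theorem inner_sq_add_inner_I_mul_sq (b v : ℂ) :
    inner ℝ b v ^ 2 + inner ℝ (Complex.I * b) v ^ 2 = (‖v‖ * ‖b‖) ^ 2 := by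
  rw [mul_pow, Complex.sq_norm, Complex.sq_norm, Complex.normSq_apply, Complex.normSq_apply]
  simp [Complex.inner]
  ring

theorem integral_cos_inner_sum {n : ℕ} {Ω : Type*} [MeasurableSpace Ω] {P : Measure Ω}
    [IsProbabilityMeasure P] {Z : Fin n → Ω → ℂ} (hZ : iIndepFun Z P)
    (hlaw : ∀ j, HasLaw (Z j) (uniformOn ({1, Complex.I, -1, -Complex.I} : Set ℂ)) P)
    (b : Fin n → ℂ) (v : ℂ) :
    ∫ ω, Real.cos (inner ℝ (∑ j, Z j ω * b j) v) ∂P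
      = ∏ j, (Real.cos (inner ℝ (b j) v) + Real.cos (inner ℝ (Complex.I * b j) v)) / 2 := by
  -- The complex exponential, unlike the cosine, factors over the sum; real parts are taken
  -- afterwards.
  have h := hZ.integral_fun_prod_comp (fun j => (hlaw j).aemeasurable)
    (f := fun j z => Complex.exp (Complex.I * (inner ℝ (z * b j) v : ℝ))) (fun j => by
      have : Continuous fun z : ℂ => Complex.exp (Complex.I * (inner ℝ (z * b j) v : ℝ)) := by
        fun_prop
      exact this.measurable.aestronglyMeasurable)
  simp only [integral_exp_inner_of_hasLaw_fourthRoots (hlaw _), ← Complex.exp_sum,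
    ← Finset.mul_sum, ← Complex.ofReal_sum, ← sum_inner, ← Complex.ofReal_prod] at h
  have h' := congrArg Complex.re h
  have hZm : AEMeasurable (fun ω => ∑ j, Z j ω * b j) P :=
    Finset.aemeasurable_fun_sum _ fun j _ => (hlaw j).aemeasurable.mul_const _
  rw [← RCLike.re_eq_complex_re, ← integral_re] at h'
  · rw [RCLike.re_eq_complex_re, Complex.ofReal_re] at h'
    rw [← h']
    refine integral_congr_ae (Filter.Eventually.of_forall fun ω => ?_)
    beta_reduce
    rw [mul_comm, Complex.exp_ofReal_mul_I_re]
  · refine Integrable.of_bound (C := 1) ?_ (Filter.Eventually.of_forall fun ω => ?_)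
    · have : Continuous fun z : ℂ => Complex.exp (Complex.I * (inner ℝ z v : ℝ)) := by fun_prop
      exact (this.measurable.comp_aemeasurable hZm).aestronglyMeasurable
    · rw [mul_comm, Complex.norm_exp_ofReal_mul_I]

/-! ### Comparison of the random sum with a Gaussian -/

section FourthRoots

variable {n : ℕ} {Ω : Type*} [MeasurableSpace Ω] {P : Measure Ω} {Z : Fin n → Ω → ℂ}

theorem aemeasurable_sum_mul_of_hasLaw {μ : Measure ℂ} (hlaw : ∀ j, HasLaw (Z j) μ P)
    (b : Fin n → ℂ) : AEMeasurable (fun ω => ∑ j, Z j ω * b j) P :=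
  Finset.aemeasurable_fun_sum _ fun j _ => (hlaw j).aemeasurable.mul_const _

theorem ae_norm_sum_mul_le
    (hlaw : ∀ j, HasLaw (Z j) (uniformOn ({1, Complex.I, -1, -Complex.I} : Set ℂ)) P)
    (b : Fin n → ℂ) : ∀ᵐ ω ∂P, ‖∑ j, Z j ω * b j‖ ≤ ∑ j, ‖b j‖ := by
  filter_upwards [ae_all_iff.2 fun j => ae_norm_eq_one_of_hasLaw_fourthRoots (hlaw j)] with ω hω
  refine (norm_sum_le _ _).trans (Finset.sum_le_sum fun j _ => ?_)
  rw [norm_mul, hω, one_mul]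

variable [IsProbabilityMeasure P]

theorem integrable_norm_sum_mul
    (hlaw : ∀ j, HasLaw (Z j) (uniformOn ({1, Complex.I, -1, -Complex.I} : Set ℂ)) P)
    (b : Fin n → ℂ) : Integrable (fun ω => ‖∑ j, Z j ω * b j‖) P :=
  Integrable.of_bound (aemeasurable_sum_mul_of_hasLaw hlaw b).norm.aestronglyMeasurable
    (∑ j, ‖b j‖) (by simpa using ae_norm_sum_mul_le hlaw b)

theorem gaussian_sub_le_integral_cos (hZ : iIndepFun Z P)
    (hlaw : ∀ j, HasLaw (Z j) (uniformOn ({1, Complex.I, -1, -Complex.I} : Set ℂ)) P)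
    {b : Fin n → ℂ} {δ : ℝ} (hb : ∀ j, ‖b j‖ ≤ δ) (hsum : ∑ j, ‖b j‖ ^ 2 = 1) (t : ℝ) (v : ℂ) :
    Real.exp (-((t * ‖v‖) ^ 2 / 4))
        - 4 * ((δ * (t * ‖v‖)) ^ 2 / (1 + (δ * (t * ‖v‖)) ^ 2))
      ≤ ∫ ω, Real.cos (inner ℝ ((t : ℂ) * ∑ j, Z j ω * b j) v) ∂P := by
  have e : ∀ ω, (t : ℂ) * ∑ j, Z j ω * b j = ∑ j, Z j ω * ((t : ℂ) * b j) := fun ω => by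
    rw [Finset.mul_sum]
    exact Finset.sum_congr rfl fun j _ => by ring
  simp only [e]
  rw [integral_cos_inner_sum hZ hlaw]
  refine gaussian_sub_le_prod_half_cos_add_cos (r := fun j => ‖b j‖) (fun j => ?_)
    (fun j => by simpa using hb j) hsum
  rw [inner_sq_add_inner_I_mul_sq, norm_mul, Complex.norm_real]
  simp only [mul_pow, Real.norm_eq_abs, sq_abs]
  ring

/-- The term `1/(1 + t²/4)` is the exact value for a complex Gaussian with `E|g|² = 1`. -/
theorem one_add_sq_inv_sub_le_integral_exp (hZ : iIndepFun Z P)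
    (hlaw : ∀ j, HasLaw (Z j) (uniformOn ({1, Complex.I, -1, -Complex.I} : Set ℂ)) P)
    {b : Fin n → ℂ} {δ : ℝ} (hb : ∀ j, ‖b j‖ ≤ δ) (hsum : ∑ j, ‖b j‖ ^ 2 = 1) (t : ℝ) :
    (1 + (1 / 2 * t) ^ 2)⁻¹ - 16 * ((δ * t) ^ 2 * (1 + (δ * t) ^ 2)⁻¹)
      ≤ ∫ ω, Real.exp (-(‖∑ j, Z j ω * b j‖ ^ 2 / 4 * t ^ 2)) ∂P := by
  have hS := aemeasurable_sum_mul_of_hasLaw hlaw b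
  set S : Ω → ℂ := fun ω => ∑ j, Z j ω * b j
  have hF : Integrable (fun x : Ω × ℂ =>
      Real.exp (-‖x.2‖ ^ 2) * Real.cos (inner ℝ ((t : ℂ) * S x.1) x.2)) (P.prod volume) := by
    refine Integrable.mono' (integrable_exp_neg_norm_sq.comp_snd P) ?_
      (Filter.Eventually.of_forall fun x => ?_)
    · have hc : Continuous fun y : ℂ × ℂ =>
          Real.exp (-‖y.2‖ ^ 2) * Real.cos (inner ℝ ((t : ℂ) * y.1) y.2) := by fun_prop
      exact (hc.measurable.comp_aemeasurable
        (hS.comp_fst.prodMk measurable_snd.aemeasurable)).aestronglyMeasurable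
    · rw [norm_mul, Real.norm_of_nonneg (Real.exp_pos _).le]
      exact mul_le_of_le_one_right (Real.exp_pos _).le (Real.abs_cos_le_one _)
  have hswap := integral_integral_swap (f := fun ω (v : ℂ) =>
    Real.exp (-‖v‖ ^ 2) * Real.cos (inner ℝ ((t : ℂ) * S ω) v)) hF
  have hleft : ∫ ω, (∫ v : ℂ, Real.exp (-‖v‖ ^ 2) * Real.cos (inner ℝ ((t : ℂ) * S ω) v)) ∂P
      = Real.pi * ∫ ω, Real.exp (-(‖S ω‖ ^ 2 / 4 * t ^ 2)) ∂P := by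
    simp only [integral_exp_neg_norm_sq_mul_cos, integral_const_mul]
    congr 1
    refine integral_congr_ae (Filter.Eventually.of_forall fun ω => ?_)
    simp only [norm_mul, Complex.norm_real, mul_pow, Real.norm_eq_abs, sq_abs]
    congr 1
    ring
  have hI1 := integrable_exp_neg_mul_norm_sq (b := 1 + (1 / 2 * t) ^ 2) (by positivity)
  have hI2 := (integrable_exp_neg_mul_norm_sq (b := 1 / 2) (by norm_num)).const_mul
    (8 * ((δ * t) ^ 2 * (1 + (δ * t) ^ 2)⁻¹))
  have hlower : ∫ v : ℂ, (Real.exp (-(1 + (1 / 2 * t) ^ 2) * ‖v‖ ^ 2)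
        - 8 * ((δ * t) ^ 2 * (1 + (δ * t) ^ 2)⁻¹) * Real.exp (-(1 / 2) * ‖v‖ ^ 2))
      ≤ ∫ v : ℂ, ∫ ω, Real.exp (-‖v‖ ^ 2) * Real.cos (inner ℝ ((t : ℂ) * S ω) v) ∂P := by
    refine integral_mono (hI1.sub hI2) hF.integral_prod_right fun v => ?_
    simp only [integral_const_mul]
    have h1 := mul_le_mul_of_nonneg_left (gaussian_sub_le_integral_cos hZ hlaw hb hsum t v)
      (Real.exp_pos (-‖v‖ ^ 2)).le
    refine le_trans ?_ h1
    have h2 := mul_div_one_add_mul_le (sq_nonneg ‖v‖) (sq_nonneg (δ * t))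
    rw [← mul_pow, show ‖v‖ * (δ * t) = δ * (t * ‖v‖) by ring] at h2
    -- Half of the Gaussian weight absorbs `1 + |v|²`, turning `4` into `8`; the remaining integral
    -- `2π` yields `16π`.
    have h3 : 1 + ‖v‖ ^ 2 ≤ 2 * Real.exp (1 / 2 * ‖v‖ ^ 2) := by
      have := Real.add_one_le_exp (1 / 2 * ‖v‖ ^ 2)
      linarith [sq_nonneg ‖v‖]
    have h4 := h2.trans (mul_le_mul_of_nonneg_right h3
      (by positivity : 0 ≤ (δ * t) ^ 2 / (1 + (δ * t) ^ 2)))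
    have h5 := mul_le_mul_of_nonneg_left h4 (Real.exp_pos (-‖v‖ ^ 2)).le
    have e1 : Real.exp (-(1 + (1 / 2 * t) ^ 2) * ‖v‖ ^ 2)
        = Real.exp (-‖v‖ ^ 2) * Real.exp (-((t * ‖v‖) ^ 2 / 4)) := by
      rw [← Real.exp_add]; congr 1; ring
    have e2 : Real.exp (-(1 / 2) * ‖v‖ ^ 2)
        = Real.exp (-‖v‖ ^ 2) * Real.exp (1 / 2 * ‖v‖ ^ 2) := by
      rw [← Real.exp_add]; congr 1; ring
    rw [e1, e2, ← div_eq_mul_inv]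
    linarith
  rw [← hswap, hleft, integral_sub hI1 hI2, integral_const_mul,
    integral_exp_neg_mul_norm_sq (by positivity), integral_exp_neg_mul_norm_sq (by norm_num)]
    at hlower
  refine le_of_mul_le_mul_left ?_ Real.pi_pos
  refine le_trans (le_of_eq ?_) hlower
  ring

theorem integral_norm_sum_mul_le_of_normalized (hZ : iIndepFun Z P)
    (hlaw : ∀ j, HasLaw (Z j) (uniformOn ({1, Complex.I, -1, -Complex.I} : Set ℂ)) P)
    {b : Fin n → ℂ} {δ : ℝ} (hδ : 0 < δ) (hb : ∀ j, ‖b j‖ ≤ δ) (hsum : ∑ j, ‖b j‖ ^ 2 = 1) :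
    ∫ ω, ‖∑ j, Z j ω * b j‖ ∂P ≤ √(Real.pi / 4) + 16 * √Real.pi * δ := by
  have hS := aemeasurable_sum_mul_of_hasLaw hlaw b
  have hbd := ae_norm_sum_mul_le hlaw b
  have hchar := one_add_sq_inv_sub_le_integral_exp hZ hlaw hb hsum
  set S : Ω → ℂ := fun ω => ∑ j, Z j ω * b j
  set M := ∑ j, ‖b j‖
  have hF : Integrable (fun x : Ω × ℝ => (1 - Real.exp (-(‖S x.1‖ ^ 2 / 4 * x.2 ^ 2))) / x.2 ^ 2)
      (P.prod (volume.restrict (Set.Ioi 0))) := by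
    -- Almost surely `|S| ≤ M`, so the integrand with `M` in place of `|S|` dominates and Fubini
    -- applies.
    refine Integrable.mono'
      ((integrableOn_one_sub_exp_div_sq (b := M ^ 2 / 4) (by positivity)).comp_snd P) ?_ ?_
    · have hc : Measurable fun y : ℂ × ℝ =>
          (1 - Real.exp (-(‖y.1‖ ^ 2 / 4 * y.2 ^ 2))) / y.2 ^ 2 := by fun_prop
      exact (hc.comp_aemeasurable
        (hS.comp_fst.prodMk measurable_snd.aemeasurable)).aestronglyMeasurable
    · filter_upwards [Measure.quasiMeasurePreserving_fst.ae hbd] with x hx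
      rw [Real.norm_of_nonneg (one_sub_exp_div_sq_nonneg (by positivity) _)]
      gcongr
  have hswap := integral_integral_swap (f := fun ω (t : ℝ) =>
    (1 - Real.exp (-(‖S ω‖ ^ 2 / 4 * t ^ 2))) / t ^ 2) hF
  simp only [integral_one_sub_exp_norm_sq_div_sq, integral_const_mul] at hswap
  have hI1 := ((integrable_inv_one_add_mul_sq (c := 1 / 2) (by norm_num)).const_mul
    (1 / 4)).integrableOn (s := Set.Ioi 0)
  have hI2 := ((integrable_inv_one_add_mul_sq hδ.ne').const_mul
    (16 * δ ^ 2)).integrableOn (s := Set.Ioi 0)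
  have hupper : ∫ t in Set.Ioi (0 : ℝ), ∫ ω,
        (1 - Real.exp (-(‖S ω‖ ^ 2 / 4 * t ^ 2))) / t ^ 2 ∂P
      ≤ ∫ t in Set.Ioi (0 : ℝ), (1 / 4 * (1 + (1 / 2 * t) ^ 2)⁻¹
        + 16 * δ ^ 2 * (1 + (δ * t) ^ 2)⁻¹) := by
    refine integral_mono_ae hF.integral_prod_right (hI1.add hI2) ?_
    filter_upwards [ae_restrict_mem measurableSet_Ioi] with t ht
    have ht' : 0 < t ^ 2 := pow_pos ht 2
    have hint : Integrable (fun ω => Real.exp (-(‖S ω‖ ^ 2 / 4 * t ^ 2))) P := by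
      have hc : Measurable fun z : ℂ => Real.exp (-(‖z‖ ^ 2 / 4 * t ^ 2)) := by fun_prop
      refine Integrable.of_bound (hc.comp_aemeasurable hS).aestronglyMeasurable 1
        (Filter.Eventually.of_forall fun ω => ?_)
      rw [Real.norm_of_nonneg (Real.exp_pos _).le, Real.exp_le_one_iff, neg_nonpos]
      positivity
    rw [integral_div, integral_sub (integrable_const _) hint, integral_const, probReal_univ,
      one_smul, div_le_iff₀ ht']
    refine le_trans (sub_le_sub_left (hchar t) 1) (le_of_eq ?_)
    field_simp
    ring
  rw [integral_add hI1 hI2, integral_const_mul, integral_const_mul,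
    integral_Ioi_inv_one_add_mul_sq (by norm_num), integral_Ioi_inv_one_add_mul_sq hδ,
    ← hswap] at hupper
  have hpos : 0 < √(Real.pi / 4) := Real.sqrt_pos.2 (by positivity)
  refine le_of_mul_le_mul_left (hupper.trans (le_of_eq ?_)) hpos
  have h4 : √(Real.pi / 4) = √Real.pi / 2 := by
    rw [Real.sqrt_div Real.pi_pos.le, show (4 : ℝ) = 2 ^ 2 by norm_num,
      Real.sqrt_sq (by norm_num)]
  have hpi : √Real.pi * √Real.pi = Real.pi := Real.mul_self_sqrt Real.pi_pos.le
  rw [h4]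
  -- With `s = √π`, both sides equal `s²/4 + 8s²δ`.
  generalize √Real.pi = s at hpi ⊢
  rw [← hpi]
  field_simp
  ring

theorem integral_norm_sum_mul_le (hZ : iIndepFun Z P)
    (hlaw : ∀ j, HasLaw (Z j) (uniformOn ({1, Complex.I, -1, -Complex.I} : Set ℂ)) P)
    {a : Fin n → ℂ} {δ N : ℝ} (hδ : 0 < δ) (hN : 0 < N) (ha : ∀ j, ‖a j‖ ≤ δ * N)
    (hsum : ∑ j, ‖a j‖ ^ 2 = N ^ 2) :
    ∫ ω, ‖∑ j, Z j ω * a j‖ ∂P ≤ (√(Real.pi / 4) + 16 * √Real.pi * δ) * N := by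
  have h := integral_norm_sum_mul_le_of_normalized hZ hlaw (b := fun j => a j / N) hδ
    (fun j => by
      rw [norm_div, Complex.norm_real, Real.norm_of_nonneg hN.le, div_le_iff₀ hN]
      exact ha j)
    (by
      simp only [norm_div, Complex.norm_real, Real.norm_of_nonneg hN.le, div_pow]
      rw [← Finset.sum_div, hsum, div_self (by positivity)])
  simp only [← mul_div_assoc, ← Finset.sum_div, norm_div, Complex.norm_real,
    Real.norm_of_nonneg hN.le, integral_div] at h
  rwa [div_le_iff₀ hN] at h

end FourthRoots

/-! ### Conclusion by homogeneity -/

theorem mainTheorem8 :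
    ∃ K : ℝ, ∀ (n : ℕ) (Ω : Type*) [MeasurableSpace Ω] (P : Measure Ω) [IsProbabilityMeasure P]
      (Z : Fin n → Ω → ℂ),
      iIndepFun Z P →
      (∀ j, HasLaw (Z j) (uniformOn ({1, Complex.I, -1, -Complex.I} : Set ℂ)) P) →
      ∀ (a : Fin n → ℂ) (ε : ℝ), 0 ≤ ε →
        ‖(WithLp.toLp ⊤ a : PiLp ⊤ fun _ : Fin n => ℂ)‖
          ≤ ε * ‖(WithLp.toLp 2 a : EuclideanSpace ℂ (Fin n))‖ →
        Integrable (fun ω => ‖∑ j, Z j ω * a j‖) P ∧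
        ∫ ω, ‖∑ j, Z j ω * a j‖ ∂P
          ≤ (√(Real.pi / 4) + K * √ε) * ‖(WithLp.toLp 2 a : EuclideanSpace ℂ (Fin n))‖ := by
  refine ⟨16 * √Real.pi, fun n Ω _ P _ Z hZ hlaw a ε hε ha => ?_⟩
  refine ⟨integrable_norm_sum_mul hlaw a, ?_⟩
  have hN2 := EuclideanSpace.norm_sq_eq (WithLp.toLp 2 a : EuclideanSpace ℂ (Fin n))
  have hcoord := fun j => PiLp.norm_apply_le (WithLp.toLp 2 a : EuclideanSpace ℂ (Fin n)) j
  have hcoord' := fun j =>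
    (PiLp.norm_apply_le (WithLp.toLp ⊤ a : PiLp ⊤ fun _ : Fin n => ℂ) j).trans ha
  have hN0 := norm_nonneg (WithLp.toLp 2 a : EuclideanSpace ℂ (Fin n))
  set N := ‖(WithLp.toLp 2 a : EuclideanSpace ℂ (Fin n))‖
  simp only at hN2 hcoord hcoord'
  by_cases ha0 : ∀ j, a j = 0
  · simp only [ha0, mul_zero, Finset.sum_const_zero, norm_zero, integral_zero]
    positivity
  obtain ⟨j, hj⟩ := not_forall.1 ha0
  have hjpos : 0 < ‖a j‖ := norm_pos_iff.2 hj
  have hNpos : 0 < N := hjpos.trans_le (hcoord j)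
  have hεpos : 0 < ε := pos_of_mul_pos_left (hjpos.trans_le (hcoord' j)) hN0
  -- Since every `|a_j| ≤ N`, `δ = 1` is always admissible; taking `δ = min ε 1` lets the linear
  -- bound imply the one in `√ε` also for `ε > 1`.
  have hmin : min ε 1 ≤ √ε := by
    rcases le_total ε 1 with h | h
    · refine (min_le_left _ _).trans (Real.le_sqrt_of_sq_le ?_)
      nlinarith
    · exact (min_le_right _ _).trans (Real.one_le_sqrt.2 h)
  refine (integral_norm_sum_mul_le hZ hlaw (lt_min hεpos one_pos) hNpos (fun i => ?_)
    hN2.symm).trans ?_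
  · rcases min_choice ε 1 with h | h <;> rw [h]
    · exact hcoord' i
    · simpa using hcoord i
  · gcongr
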